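/- Let $q,r,\mu,\nu$ be positive integers with $q+1\le\nu<q+r$ (so $r\ge 2$), and let $z$ be a real or complex number. Matrix and block indices start at $0$. Let $u(z)=(1,z,\dots,z^{q-1})^\top$, $w(z)=(1,z,\dots,z^{r-1})$, $M(z)=u(z)w(z)$, and for $k\ge 0$ let $$\mathcal N^k(z)=\frac1{k!}\Big(\frac{M^{(k)}(z)}{0!},\frac{M^{(k+1)}(z)}{1!},\dots,\frac{M^{(k+\nu-1)}(z)}{(\nu-1)!}\Big)$$ (of size $q\times\nu r$). Let $\mathcal N(z)$ be the $\mu q\times\nu r$ matrix with block rows $\mathcal N^0(z),\dots,\mathcal N^{\mu-1}(z)$, that is, with blocks $\frac{1}{i!\,j!}M^{(i+j)}(z)$, $0\le i<\mu$, $0\le j<\nu$. Let $S_n$ be the $n\times n$ shift matrix with entries $\delta_{i+1,j}$, and let $G(z)$ be the $r\times r$ matrix with entries $z^{j-i-1}$ for $j>i$ and $0$ otherwise, so that $G(z)=S_r(I-zS_r)^{-1}$. For $j\ge0$ let $F_j(z)$ be the $(r-j)\times(r-j-1)$ matrix with $-z$ on the diagonal, $1$ on the first subdiagonal and $0$ elsewhere,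 and let $G_{j0}(z)$ consist of the first $r-j$ rows of $G(z)$; negative sizes are read as $0$. Let $\ell$ be the last standard basis vector of length $q$ and $\mathrm f$ the first one of length $\nu-q$. Put $$\bar K_j(z)=\begin{pmatrix} I_q\otimes F_j(z)+S_q\otimes F_j'(z) & -\ell\,\mathrm f^\top\otimes\frac1{j!}G_{j0}^{(j)}(z)\\ 0& I_{\nu-q}\otimes I_r-S_{\nu-q}\otimes G(z)\end{pmatrix}.$$ For $j\ge r$ only the lower right block is left. For $j=r-1$ the left blocks have no columns and the upper right block is zero, since $G_{r-1,0}^{(r-1)}(z)=0$. For $i\ge0$ put $\bar{\mathcal K}^i(z)=\bar K_0(z)\bar K_1(z)\cdots\bar K_i(z)$. Theorem. 1. $\mathcal N^k(z)\bar{\mathcal K}^i(z)=0$ for all $i\ge k\ge 0$. 2. If $\mu\le r-1$, then $\bar{\mathcal K}^{\mu-1}(z)$ has size $\nu r\times(\nu r-q\mu)$ and rank $\nu r-q\mu$. If $\mu\ge r$, then it has size $\nu r\times(\nu-q)r$ and rank $(\nu-q)r$. In both cases it has full column rank. 3. The columns of $\bar{\mathcal K}^{\mu-1}(z)$ span $\ker\mathcal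 N(z)$, which has dimension $\nu r-q\min\{\mu,r\}$. 4. $\operatorname{rank}\mathcal N(z)=q\min\{\mu,r\}<\nu r$; hence $\mathcal N(z)$ never has full column rank. -/

import Mathlib

open scoped Kronecker Nat

noncomputable section

namespace BlockHankel

variable {𝕜 : Type*} [NontriviallyNormedField 𝕜]

/-- The `k`-th derivative of a matrix-valued function of one variable, taken entrywise. -/
def matDeriv {m n : Type*} (k : ℕ) (A : 𝕜 → Matrix m n 𝕜) (z : 𝕜) : Matrix m n 𝕜 :=
  Matrix.of fun i j => iteratedDeriv k (fun x => A x i j) z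

/-- The vector `(1, z, …, z ^ (n - 1))`; it is `u(z)` for `n = q` and `w(z)` for `n = r`. -/
def powVec (n : ℕ) (z : 𝕜) : Fin n → 𝕜 := fun i => z ^ (i : ℕ)

/-- The `q × r` matrix `M(z) = u(z) w(z)`, column times row. -/
def M (q r : ℕ) (z : 𝕜) : Matrix (Fin q) (Fin r) 𝕜 :=
  Matrix.vecMulVec (powVec q z) (powVec r z)

/-- The `q × ν r` block row `𝒩^k(z)`, with blocks `M^{(k+j)}(z) / (k! j!)`, `0 ≤ j < ν`. -/
def blockRow (q r ν k : ℕ) (z : 𝕜) : Matrix (Fin q) (Fin ν × Fin r) 𝕜 :=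
  Matrix.of fun a c =>
    ((k ! : 𝕜) * ((c.1 : ℕ)! : 𝕜))⁻¹ * matDeriv (k + c.1) (M q r) z a c.2

/-- The `μ q × ν r` matrix `𝒩(z)`, with blocks `M^{(i+j)}(z) / (i! j!)`,
`0 ≤ i < μ`, `0 ≤ j < ν`. -/
def calN (q r μ ν : ℕ) (z : 𝕜) : Matrix (Fin μ × Fin q) (Fin ν × Fin r) 𝕜 :=
  Matrix.of fun a c =>
    (((a.1 : ℕ)! : 𝕜) * ((c.1 : ℕ)! : 𝕜))⁻¹ * matDeriv ((a.1 : ℕ) + c.1) (M q r) z a.2 c.2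

/-- The `n × n` shift matrix, with entries `δ_{i+1,j}`. -/
def shift (𝕜 : Type*) [NontriviallyNormedField 𝕜] (n : ℕ) : Matrix (Fin n) (Fin n) 𝕜 :=
  Matrix.of fun i j => if (i : ℕ) + 1 = j then 1 else 0

/-- The `(r - k) × (r - k - 1)` matrix `F_k(z)`, with `-z` on the diagonal, `1` just below it and
`0` elsewhere. It has no columns for `k ≥ r - 1` and neither rows nor columns for `k ≥ r`. -/
def F (r k : ℕ) (z : 𝕜) : Matrix (Fin (r - k)) (Fin (r - (k + 1))) 𝕜 :=
  Matrix.of fun i j => if (i : ℕ) = j then -z else if (i : ℕ) = j + 1 then 1 else 0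

/-- The `r × r` matrix `G(z)`, with entries `z ^ (j - i - 1)` for `j > i` and `0` elsewhere. -/
def G (r : ℕ) (z : 𝕜) : Matrix (Fin r) (Fin r) 𝕜 :=
  Matrix.of fun i j => if (i : ℕ) < j then z ^ ((j : ℕ) - i - 1) else 0

/-- `G(z) = S (I - z S)⁻¹`, with an honest inverse. -/
theorem G_eq (r : ℕ) (z : 𝕜) :
    IsUnit (1 - z • shift 𝕜 r).det ∧ G r z = shift 𝕜 r * (1 - z • shift 𝕜 r)⁻¹ := by
  have hdet : (1 - z • shift 𝕜 r).det = 1 := by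
    rw [Matrix.det_of_isUpperTriangular]
    · simp [shift]
    · intro i j hij
      have h : (j : ℕ) < i := hij
      have h1 : (i : ℕ) + 1 ≠ j := by omega
      have h2 : i ≠ j := by rintro rfl; omega
      simp [shift, h1, h2]
  have hu : IsUnit (1 - z • shift 𝕜 r).det := by rw [hdet]; exact isUnit_one
  refine ⟨hu, ?_⟩
  have key : G r z * (1 - z • shift 𝕜 r) = shift 𝕜 r := by
    ext i j
    rw [mul_sub, mul_one, Matrix.sub_apply, mul_smul_comm, Matrix.smul_apply, Matrix.mul_apply,
      smul_eq_mul]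
    rcases Nat.eq_zero_or_pos (j : ℕ) with hj | hj
    · have : ∑ x, G r z i x * shift 𝕜 r x j = 0 :=
        Finset.sum_eq_zero fun x _ => by simp [shift, hj]
      rw [this]
      have h0 : ¬ (i : ℕ) < j := by omega
      simp only [G, shift, Matrix.of_apply, h0, if_false, mul_zero, sub_zero]
      rw [if_neg (by omega)]
    · have hlt : (j : ℕ) - 1 < r := by have := j.2; omega
      rw [Finset.sum_eq_single (⟨(j : ℕ) - 1, hlt⟩ : Fin r)]
      · have e : (j : ℕ) - 1 + 1 = j := by omega
        simp only [G, shift, Matrix.of_apply, e, if_true, mul_one]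
        by_cases h1 : (i : ℕ) + 1 = j
        · have a : (i : ℕ) < j := by omega
          have b : ¬ (i : ℕ) < (j : ℕ) - 1 := by omega
          have c : (j : ℕ) - i - 1 = 0 := by omega
          simp [h1, a, b, c]
        · by_cases a : (i : ℕ) < j
          · have b : (i : ℕ) < (j : ℕ) - 1 := by omega
            have c : (j : ℕ) - i - 1 = ((j : ℕ) - 1 - i - 1) + 1 := by omega
            simp only [a, b, h1, if_true, if_false]
            rw [c, pow_succ]
            ring
          · have b : ¬ (i : ℕ) < (j : ℕ) - 1 := by omega
            simp [a, b, h1]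
      · intro b _ hb
        have : (b : ℕ) + 1 ≠ j := by
          intro h
          exact hb (Fin.ext (by simp; omega))
        simp [shift, this]
      · simp
  rw [← Matrix.mul_nonsing_inv_cancel_right _ (G r z) hu, key]

/-- The matrix `G_{k0}(z)` of size `(r - k) × r`: the first `r - k` rows of `G(z)`. -/
def Gtop (r k : ℕ) (z : 𝕜) : Matrix (Fin (r - k)) (Fin r) 𝕜 :=
  (G r z).submatrix (Fin.castLE (Nat.sub_le r k)) id

/-- The `m × n` matrix `ℓ_m f_n^⊤`, with `ℓ_m` the last standard basis vector of length `m` and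
`f_n` the first one of length `n`. -/
def corner (𝕜 : Type*) [NontriviallyNormedField 𝕜] (m n : ℕ) : Matrix (Fin m) (Fin n) 𝕜 :=
  Matrix.of fun i j => if (i : ℕ) + 1 = m ∧ (j : ℕ) = 0 then 1 else 0

/-- Row index of `K̄_j(z)`, and column index of `K̄_{j-1}(z)`: `q` blocks of size `r - j` followed
by `ν - q` blocks of size `r`. The first `q` blocks are empty when `j ≥ r`. -/
abbrev BIdx (q r ν j : ℕ) : Type := (Fin q × Fin (r - j)) ⊕ (Fin (ν - q) × Fin r)

/-- The matrix `K̄_j(z)`. For `j = r - 1` the two left blocks have no columns and the upper right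
one has a single zero row in each of its blocks; for `j ≥ r` only the lower right block is left. -/
def Kbar (q r ν j : ℕ) (z : 𝕜) : Matrix (BIdx q r ν j) (BIdx q r ν (j + 1)) 𝕜 :=
  Matrix.fromBlocks
    ((1 : Matrix (Fin q) (Fin q) 𝕜) ⊗ₖ F r j z + shift 𝕜 q ⊗ₖ matDeriv 1 (F r j) z)
    (-(corner 𝕜 q (ν - q) ⊗ₖ ((j ! : 𝕜)⁻¹ • matDeriv j (Gtop r j) z)))
    0
    ((1 : Matrix (Fin (ν - q)) (Fin (ν - q)) 𝕜) ⊗ₖ (1 : Matrix (Fin r) (Fin r) 𝕜)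
      - shift 𝕜 (ν - q) ⊗ₖ G r z)

/-- The product `K̄_0(z) K̄_1(z) ⋯ K̄_i(z)`. -/
def KbarProd (q r ν : ℕ) : (i : ℕ) → 𝕜 → Matrix (BIdx q r ν 0) (BIdx q r ν (i + 1)) 𝕜
  | 0, z => Kbar q r ν 0 z
  | i + 1, z => KbarProd q r ν i z * Kbar q r ν (i + 1) z

/-- The `ν` blocks of size `r`, split into the first `q` and the last `ν - q` of them. -/
def splitIdx (q r ν : ℕ) (c : Fin ν × Fin r) : BIdx q r ν 0 :=
  if h : (c.1 : ℕ) < q then Sum.inl (⟨c.1, h⟩, c.2)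
  else Sum.inr (⟨(c.1 : ℕ) - q, by have := c.1.2; omega⟩, c.2)

/-- The matrix `𝒦̄^i(z) = K̄_0(z) K̄_1(z) ⋯ K̄_i(z)`, with its rows indexed by the `ν` blocks of
size `r` in their natural order. -/
def calKbar (q r ν i : ℕ) (z : 𝕜) : Matrix (Fin ν × Fin r) (BIdx q r ν (i + 1)) 𝕜 :=
  (KbarProd q r ν i z).submatrix (splitIdx q r ν) id

end BlockHankel

end

noncomputable section

namespace BlockHankel

/-! A vector with `ν` blocks of length `r` is read as a sequence of polynomials `x_0, …, x_{ν-1}` of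
degree below `r`. With `D_j` the `j`-th Hasse derivative, the entry `a` of `𝒩^k(z) x` is `D_k` of
`L_a = ∑ D_j (t^a x_j)`, evaluated at `z`. So `x` lies in `ker 𝒩(z)` iff `(t - z)^μ` divides `L_a`
for all `a < q`. By the Leibniz rule (`leibnizSum_eq`), `L_a` is a unitriangular combination of `E_k
= ∑ D_j x_{k+j}`, `k ≤ a`.

The substitution `x_k ↦ (t - z) x_k - x_{k+1}` multiplies each `E_k` by `t - z`
(`expShift_X_sub_C_mul_sub`). `K̄_j(z)` performs it on the first `q` polynomials. On the others,
carried as divided differences, it does so up to constants, which do not reach `E_k` for `k < q`.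
Hence `i + 1` factors produce the divisor `(t - z)^(i+1)`, which gives the annihilation.

Each `K̄_j(z)` is injective, so the kernel has dimension at least `ν r - q min(μ, r)`. The first
`min(μ, r)` block rows of `𝒩(z)` are independent by the same calculus with rows and columns
exchanged (`eq_zero_of_leibnizSum`). Rank-nullity makes both bounds sharp. -/

open Polynomial Finset

/-! ### Sums of Hasse derivatives of polynomial sequences -/

section PolynomialModel

variable {K : Type*} [Field K]

/-- The sum `∑ j < n, D^j (x (k + j)) / j!`, for a sequence `x` of polynomials. -/
def expShift (n : ℕ) (x : ℕ → K[X]) (k : ℕ) : K[X] :=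
  ∑ j ∈ range n, hasseDeriv j (x (k + j))

/-- The sum `∑ j < n, D^j (t^a x_j) / j!`, for a sequence `x` of polynomials in `t`. -/
def leibnizSum (n : ℕ) (x : ℕ → K[X]) (a : ℕ) : K[X] :=
  ∑ j ∈ range n, hasseDeriv j (X ^ a * x j)

theorem hasseDeriv_X_pow (k n : ℕ) :
    hasseDeriv k (X ^ n : K[X]) = C (n.choose k : K) * X ^ (n - k) := by
  rw [← monomial_one_right_eq_X_pow, hasseDeriv_monomial, mul_one, C_mul_X_pow_eq_monomial]

/-- Only the Hasse derivatives of order 0 and 1 of a linear factor survive in the Leibniz rule; on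
coefficients this is Pascal's rule. -/
theorem hasseDeriv_X_sub_C_mul (z : K) (j : ℕ) (f : K[X]) :
    hasseDeriv (j + 1) ((X - C z) * f) =
      (X - C z) * hasseDeriv (j + 1) f + hasseDeriv j f := by
  ext n
  rcases n with _ | n
  · simp only [sub_mul, map_sub, coeff_sub, coeff_add, hasseDeriv_coeff, coeff_C_mul, coeff_X_mul,
      mul_coeff_zero, coeff_X_zero, zero_mul, ← add_assoc]
    simp
    ring
  · have h : ((n + 1 + (j + 1)).choose (j + 1) : K) =
        ((n + 1 + j).choose j : K) + ((n + (j + 1)).choose (j + 1) : K) := by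
      rw [show n + 1 + (j + 1) = (n + 1 + j) + 1 by ring, Nat.choose_succ_succ]
      push_cast
      congr 3
      ring
    simp only [sub_mul, map_sub, coeff_sub, coeff_add, hasseDeriv_coeff, coeff_C_mul, coeff_X_mul]
    rw [h]
    rw [show n + 1 + (j + 1) = (n + 1 + j) + 1 by ring, coeff_X_mul,
      show n + (j + 1) = n + 1 + j by ring]
    ring

/-- Leibniz rule, collected by the order `k` of the derivative that falls on `t^a`. Since this
derivative is 0 for `k > a` and 1 for `k = a`, the relation is unitriangular. -/
theorem leibnizSum_eq (n : ℕ) (x : ℕ → K[X]) (hx : ∀ k, n ≤ k → x k = 0) (a : ℕ) :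
    leibnizSum n x a = ∑ k ∈ range n, hasseDeriv k (X ^ a) * expShift n x k := by
  have h1 : leibnizSum n x a = ∑ j ∈ range n, ∑ k ∈ range n,
      if k ≤ j then hasseDeriv k (X ^ a) * hasseDeriv (j - k) (x j) else 0 := by
    refine sum_congr rfl fun j hj => ?_
    rw [hasseDeriv_mul, Nat.sum_antidiagonal_eq_sum_range_succ_mk, ← sum_filter]
    refine sum_congr ?_ fun _ _ => rfl
    ext k
    simp only [mem_range, mem_filter] at hj ⊢
    omega
  rw [h1, sum_comm]
  refine sum_congr rfl fun k hk => ?_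
  rw [expShift, mul_sum, ← sum_filter]
  have hk' : k < n := mem_range.1 hk
  -- `expShift` runs over a range independent of `k`; the surplus terms have `k + j ≥ n` and vanish.
  have h2 : ∑ j ∈ range n, hasseDeriv k (X ^ a) * hasseDeriv j (x (k + j)) =
      ∑ j ∈ range (n - k), hasseDeriv k (X ^ a) * hasseDeriv j (x (k + j)) := by
    symm
    refine sum_subset (range_subset_range.2 (Nat.sub_le _ _)) fun j _ hj => ?_
    rw [hx _ (by simp at hj; omega)]
    simp
  have h3 : (range n).filter (fun j => k ≤ j) = Ico k n := by
    ext j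
    simp
    omega
  rw [h2, h3, sum_Ico_eq_sum_range]
  refine sum_congr rfl fun j _ => ?_
  rw [Nat.add_sub_cancel_left]

/-- The extra terms `D_{j-1} x_{k+j}` from differentiating the factor `t - z` telescope against the
shifted sequence `x_{k+1}`. Constants survive only in the term `j = 0`. -/
theorem expShift_X_sub_C_mul_sub (n : ℕ) (z : K) (x y : ℕ → K[X]) (c : ℕ → K)
    (hx : ∀ k, n ≤ k → x k = 0)
    (hy : ∀ k, y k = (X - C z) * x k - x (k + 1) + C (c k)) (k : ℕ) (hn : 0 < n) :
    expShift n y k = (X - C z) * expShift n x k + C (c k) := by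
  obtain ⟨n, rfl⟩ : ∃ m, n = m + 1 := ⟨n - 1, by omega⟩
  have h0 : ∀ j, hasseDeriv (j + 1) (y (k + (j + 1))) =
      (X - C z) * hasseDeriv (j + 1) (x (k + (j + 1))) + hasseDeriv j (x (k + (j + 1)))
        - hasseDeriv (j + 1) (x (k + (j + 1) + 1)) := fun j => by
    rw [hy, map_add, map_sub, hasseDeriv_X_sub_C_mul, hasseDeriv_C _ _ (Nat.succ_pos j), add_zero]
  -- The upper end of the telescope is `D_n x_{k+n+1}`, zero because the length is now `n + 1`.
  have h1 : ∑ j ∈ range n, (hasseDeriv (j + 1) (x (k + (j + 1) + 1)) -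
      hasseDeriv j (x (k + (j + 1)))) = - x (k + 1) := by
    have := sum_range_sub (fun j => hasseDeriv j (x (k + (j + 1)))) n
    simp only [← add_assoc] at this ⊢
    rw [this, hx (k + n + 1) (by omega)]
    simp
  rw [expShift, expShift, sum_range_succ', sum_range_succ', sum_congr rfl fun j _ => h0 j,
    mul_add, mul_sum]
  simp only [add_zero, hasseDeriv_zero', hy k]
  have h2 : ∑ j ∈ range n, ((X - C z) * hasseDeriv (j + 1) (x (k + (j + 1))) +
      hasseDeriv j (x (k + (j + 1))) - hasseDeriv (j + 1) (x (k + (j + 1) + 1))) =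
      ∑ j ∈ range n, (X - C z) * hasseDeriv (j + 1) (x (k + (j + 1))) -
      ∑ j ∈ range n, (hasseDeriv (j + 1) (x (k + (j + 1) + 1)) -
      hasseDeriv j (x (k + (j + 1)))) := by
    rw [← sum_sub_distrib]
    exact sum_congr rfl fun _ _ => by ring
  rw [h2, h1]
  ring

theorem eval_hasseDeriv_eq_zero_of_dvd {z : K} {m : ℕ} {f : K[X]} (h : (X - C z) ^ m ∣ f) {k : ℕ}
    (hk : k < m) : (hasseDeriv k f).eval z = 0 := by
  rw [X_sub_C_pow_dvd_iff, X_pow_dvd_iff] at h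
  rw [← taylor_coeff, taylor_apply]
  exact h k hk

theorem dvd_of_eval_hasseDeriv_eq_zero {z : K} {m : ℕ} {f : K[X]}
    (h : ∀ k < m, (hasseDeriv k f).eval z = 0) : (X - C z) ^ m ∣ f := by
  rw [X_sub_C_pow_dvd_iff, X_pow_dvd_iff]
  intro k hk
  rw [← taylor_apply, taylor_coeff, h k hk]

/-- A common divisor of the first `a + 1` members of `expShift n x` divides
`leibnizSum n x a`. -/
theorem dvd_leibnizSum {n a : ℕ} {x : ℕ → K[X]} {p : K[X]} (hx : ∀ k, n ≤ k → x k = 0)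
    (h : ∀ k ≤ a, p ∣ expShift n x k) : p ∣ leibnizSum n x a := by
  rw [leibnizSum_eq n x hx]
  refine dvd_sum fun k _ => ?_
  by_cases hk : k ≤ a
  · exact (h k hk).mul_left _
  · rw [hasseDeriv_X_pow, Nat.choose_eq_zero_of_lt (not_le.1 hk)]
    simp

/-- The sum with index `k` is `x_k` plus derivatives of later members, so the sequence vanishes from
its end backwards. -/
theorem eq_zero_of_expShift_eq_zero {n : ℕ} {x : ℕ → K[X]} (hx : ∀ k, n ≤ k → x k = 0)
    (h : ∀ k < n, expShift n x k = 0) (k : ℕ) : x k = 0 := by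
  by_cases hk : n ≤ k
  · exact hx k hk
  · push Not at hk
    induction hd : n - k using Nat.strong_induction_on generalizing k with
    | _ d ih =>
      have h1 : ∀ j ∈ range n, j ≠ 0 → hasseDeriv j (x (k + j)) = 0 := fun j _ hj => by
        by_cases hkj : n ≤ k + j
        · rw [hx _ hkj, map_zero]
        · rw [ih (n - (k + j)) (by omega) (k + j) (by omega) rfl, map_zero]
      have h2 := h k hk
      rw [expShift, sum_eq_single_of_mem 0 (by simp; omega) h1] at h2
      simpa using h2

theorem degree_expShift_lt {n d : ℕ} {x : ℕ → K[X]} (hx : ∀ k, (x k).degree < d) (k : ℕ) :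
    (expShift n x k).degree < d := by
  refine mem_degreeLT.1 (Submodule.sum_mem _ fun j _ => mem_degreeLT.2 ?_)
  refine (degree_lt_iff_coeff_zero _ _).2 fun m hm => ?_
  rw [hasseDeriv_coeff, (degree_lt_iff_coeff_zero _ _).1 (hx _) _ (by omega), mul_zero]

/-- If the first `r` sums `∑ j < n, D^j (t^b x_j) / j!` vanish at `z` to an order that exceeds the
degree of all `x_j`, and `n ≤ r`, then `x = 0`. -/
theorem eq_zero_of_leibnizSum {n r d : ℕ} {z : K} {x : ℕ → K[X]} (hx : ∀ k, n ≤ k → x k = 0)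
    (hdeg : ∀ k, (x k).degree < d) (hnr : n ≤ r)
    (h : ∀ b < r, (X - C z) ^ d ∣ leibnizSum n x b) (k : ℕ) : x k = 0 := by
  refine eq_zero_of_expShift_eq_zero hx (fun b hb => ?_) k
  induction b using Nat.strong_induction_on with
  | _ b ih =>
    -- Earlier sums vanish by induction and later ones carry a zero binomial, so the divisor of
    -- degree `d` divides the single sum `b`, whose degree is below `d`.
    have h1 := h b (by omega)
    rw [leibnizSum_eq n x hx, sum_eq_single_of_mem b (mem_range.2 hb)] at h1
    · rw [hasseDeriv_X_pow, Nat.choose_self, Nat.sub_self, pow_zero, Nat.cast_one, map_one, one_mul,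
        one_mul] at h1
      refine eq_zero_of_dvd_of_degree_lt h1 ?_
      rw [degree_pow, degree_X_sub_C, nsmul_one]
      exact degree_expShift_lt hdeg b
    · intro k hk hkb
      rcases lt_or_gt_of_ne hkb with hlt | hgt
      · rw [ih k hlt (mem_range.1 hk), mul_zero]
      · rw [hasseDeriv_X_pow, Nat.choose_eq_zero_of_lt hgt]
        simp

/-! ### Divided differences and coefficient vectors -/

/-- The divided difference `f ↦ (f - f(z)) / (t - z)`. -/
def divDiff (z : K) : K[X] →ₗ[K] K[X] where
  toFun f := f /ₘ (X - C z)
  map_add' f g := by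
    refine mul_left_cancel₀ (X_sub_C_ne_zero z) ?_
    have h := fun p : K[X] => modByMonic_add_div p (X - C z)
    simp only [modByMonic_X_sub_C_eq_C_eval] at h
    have h1 := h f
    have h2 := h g
    have h3 := h (f + g)
    rw [eval_add, C_add] at h3
    linear_combination h3 - h1 - h2
  map_smul' c f := by
    refine mul_left_cancel₀ (X_sub_C_ne_zero z) ?_
    have h := fun p : K[X] => modByMonic_add_div p (X - C z)
    simp only [modByMonic_X_sub_C_eq_C_eval] at h
    have h1 := h f
    have h2 := h (c • f)
    rw [eval_smul, smul_eq_mul, C_mul] at h2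
    simp only [smul_eq_C_mul, RingHom.id_apply] at h2 ⊢
    linear_combination h2 - C c * h1

theorem X_sub_C_mul_divDiff (z : K) (f : K[X]) :
    (X - C z) * divDiff z f = f - C (f.eval z) := by
  have h := modByMonic_add_div f (X - C z)
  rw [modByMonic_X_sub_C_eq_C_eval] at h
  exact eq_sub_of_add_eq' h

theorem coeff_divDiff_rec (z : K) (f : K[X]) (a : ℕ) :
    (divDiff z f).coeff a = f.coeff (a + 1) + z * (divDiff z f).coeff (a + 1) :=
  coeff_divByMonic_X_sub_C_rec f z a

theorem coeff_divDiff_eq_zero (z : K) (f : K[X]) (a : ℕ) (h : ∀ i, a < i → f.coeff i = 0) :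
    (divDiff z f).coeff a = 0 := by
  refine (coeff_divByMonic_X_sub_C f z a).trans (sum_eq_zero fun i hi => ?_)
  rw [h i (by simp at hi; omega), mul_zero]

/-- These coefficients are the entries of `G^{(j)}(z) / j!`, so the upper right block of `K̄_j(z)`
is, up to sign, an iterated divided difference. -/
theorem coeff_divDiff_iterate_X_pow (z : K) (j b a : ℕ) :
    (((divDiff z) ^ (j + 1)) (X ^ b : K[X])).coeff a =
      if a < b then ((b - a - 1).choose j : K) * z ^ (b - a - 1 - j) else 0 := by
  induction j generalizing a with
  | zero =>
    rw [zero_add, pow_one]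
    by_cases hab : a < b
    · rw [if_pos hab]
      obtain ⟨d, rfl⟩ : ∃ d, b = a + 1 + d := ⟨b - a - 1, by omega⟩
      clear hab
      induction d generalizing a with
      | zero =>
        rw [coeff_divDiff_rec, coeff_divDiff_eq_zero _ _ (a + 1)]
        · simp
        · intro i hi
          rw [coeff_X_pow, if_neg (by omega)]
      | succ d ih =>
        have := ih (a + 1)
        rw [show a + 1 + 1 + d = a + 1 + (d + 1) by ring] at this
        rw [coeff_divDiff_rec, this, coeff_X_pow, if_neg (by omega)]
        simp only [show a + 1 + (d + 1) - (a + 1) - 1 = d by omega,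
          show a + 1 + (d + 1) - a - 1 = d + 1 by omega]
        simp
        ring
    · rw [if_neg hab]
      refine coeff_divDiff_eq_zero _ _ _ fun i hi => ?_
      rw [coeff_X_pow, if_neg (by omega)]
  | succ j ih =>
    rw [pow_succ', Module.End.mul_apply]
    by_cases hab : a < b
    · rw [if_pos hab]
      obtain ⟨d, rfl⟩ : ∃ d, b = a + 1 + d := ⟨b - a - 1, by omega⟩
      clear hab
      induction d generalizing a with
      | zero =>
        rw [coeff_divDiff_rec, coeff_divDiff_eq_zero _ _ (a + 1), ih, if_neg (by omega)]
        · simp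
        · intro i hi
          rw [ih, if_neg (by omega)]
      | succ d ihd =>
        have := ihd (a + 1)
        rw [show a + 1 + 1 + d = a + 1 + (d + 1) by ring] at this
        rw [coeff_divDiff_rec, this ih, ih, if_pos (by omega)]
        simp only [show a + 1 + (d + 1) - (a + 1) - 1 = d by omega,
          show a + 1 + (d + 1) - a - 1 = d + 1 by omega, Nat.choose_succ_succ]
        -- For `d ≤ j` the truncated exponent `d - (j + 1)` is harmless, as its binomial coefficient
        -- is zero.
        rcases lt_or_ge d (j + 1) with hd | hd
        · rw [Nat.choose_eq_zero_of_lt hd, show d + 1 - (j + 1) = d - j by omega]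
          simp
        · obtain ⟨e, rfl⟩ := Nat.exists_eq_add_of_le hd
          rw [show j + 1 + e - j = e + 1 by omega, show j + 1 + e - (j + 1) = e by omega,
            show j + 1 + e + 1 - (j + 1) = e + 1 by omega]
          push_cast
          ring
    · rw [if_neg hab]
      refine coeff_divDiff_eq_zero _ _ _ fun i hi => ?_
      rw [ih, if_neg (by omega)]

/-- The polynomial with a given vector of coefficients. -/
def vecPoly (n : ℕ) : (Fin n → K) →ₗ[K] K[X] :=
  ∑ i : Fin n, (monomial (i : ℕ)).comp (LinearMap.proj i)

theorem vecPoly_apply (n : ℕ) (v : Fin n → K) : vecPoly n v = ∑ i, v i • X ^ (i : ℕ) := by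
  simp [vecPoly, smul_X_eq_monomial]

theorem coeff_vecPoly (n : ℕ) (v : Fin n → K) (a : ℕ) :
    (vecPoly n v).coeff a = if h : a < n then v ⟨a, h⟩ else 0 := by
  rw [vecPoly_apply, finsetSum_coeff]
  simp only [coeff_smul, coeff_X_pow, smul_eq_mul, mul_ite, mul_one, mul_zero]
  split_ifs with h
  · rw [sum_eq_single_of_mem ⟨a, h⟩ (mem_univ _)]
    · simp
    · intro b _ hb
      rw [if_neg]
      rintro rfl
      exact hb rfl
  · refine sum_eq_zero fun b _ => if_neg ?_
    have := b.2
    omega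

theorem vecPoly_injective (n : ℕ) : Function.Injective (vecPoly (K := K) n) := by
  intro v w h
  ext i
  have := congrArg (fun p => coeff p i) h
  simpa [coeff_vecPoly] using this

theorem degree_vecPoly_lt (n : ℕ) (v : Fin n → K) : (vecPoly n v).degree < n := by
  refine (degree_lt_iff_coeff_zero _ _).2 fun m hm => ?_
  rw [coeff_vecPoly, dif_neg (by omega)]

end PolynomialModel

/-! ### The matrix `𝒩(z)` in terms of Hasse derivatives at `z` -/

variable {𝕜 : Type*} [NontriviallyNormedField 𝕜]

theorem eval_hasseDeriv_X_pow (z : 𝕜) [CharZero 𝕜] (i j n : ℕ) :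
    (hasseDeriv i (hasseDeriv j (X ^ n : 𝕜[X]))).eval z =
      ((i ! : 𝕜) * (j ! : 𝕜))⁻¹ * iteratedDeriv (i + j) (fun x => x ^ n) z := by
  have h : hasseDeriv i (hasseDeriv j (X ^ n : 𝕜[X])) =
      ((i + j).choose i) • hasseDeriv (i + j) (X ^ n : 𝕜[X]) := by
    rw [← LinearMap.comp_apply, hasseDeriv_comp, LinearMap.smul_apply]
  have hi : (i ! : 𝕜) ≠ 0 := Nat.cast_ne_zero.2 i.factorial_ne_zero
  have hj : (j ! : 𝕜) ≠ 0 := Nat.cast_ne_zero.2 j.factorial_ne_zero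
  have hc : ((i + j).choose i : 𝕜) * i ! * j ! = (i + j)! := by
    rw [Nat.choose_symm_add]
    exact_mod_cast Nat.add_choose_mul_factorial_mul_factorial i j
  rw [h, hasseDeriv_X_pow, iteratedDeriv_pow, Nat.descFactorial_eq_factorial_mul_choose]
  simp only [nsmul_eq_mul, eval_mul, eval_natCast, eval_C, eval_pow, eval_X]
  push_cast
  rw [← hc]
  field_simp

theorem inv_factorial_mul_matDeriv_M [CharZero 𝕜] (q r i j : ℕ) (z : 𝕜) (a : Fin q) (b : Fin r) :
    ((i ! : 𝕜) * (j ! : 𝕜))⁻¹ * matDeriv (i + j) (M q r) z a b =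
      (hasseDeriv i (hasseDeriv j (X ^ (a : ℕ) * X ^ (b : ℕ) : 𝕜[X]))).eval z := by
  rw [← pow_add, eval_hasseDeriv_X_pow]
  simp [matDeriv, M, powVec, Matrix.vecMulVec_apply, pow_add]

/-- A finite sequence of coefficient vectors, as a sequence of polynomials. -/
def polySeq (n r : ℕ) (x : Fin n × Fin r → 𝕜) (k : ℕ) : 𝕜[X] :=
  if h : k < n then vecPoly r (fun b => x (⟨k, h⟩, b)) else 0

theorem polySeq_eq_zero (n r : ℕ) (x : Fin n × Fin r → 𝕜) (k : ℕ) (h : n ≤ k) :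
    polySeq n r x k = 0 := dif_neg (by omega)

theorem polySeq_fin (n r : ℕ) (x : Fin n × Fin r → 𝕜) (k : Fin n) :
    polySeq n r x k = vecPoly r (fun b => x (k, b)) := dif_pos k.2

theorem degree_polySeq_lt (n r : ℕ) (x : Fin n × Fin r → 𝕜) (k : ℕ) :
    (polySeq n r x k).degree < r := by
  unfold polySeq
  split_ifs
  · exact degree_vecPoly_lt _ _
  · rw [degree_zero]
    exact WithBot.bot_lt_coe r

theorem eq_zero_of_polySeq {n r : ℕ} {x : Fin n × Fin r → 𝕜} (h : ∀ k, polySeq n r x k = 0) :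
    x = 0 := by
  ext ⟨k, b⟩
  have := h k
  rw [polySeq_fin] at this
  exact congrFun (vecPoly_injective r (this.trans (map_zero _).symm)) b

theorem leibnizSum_polySeq (n r a : ℕ) (x : Fin n × Fin r → 𝕜) :
    leibnizSum n (polySeq n r x) a =
      ∑ c : Fin n × Fin r, x c • hasseDeriv (c.1 : ℕ) (X ^ a * X ^ (c.2 : ℕ)) := by
  rw [leibnizSum, sum_range, Fintype.sum_prod_type]
  refine sum_congr rfl fun k _ => ?_
  rw [polySeq_fin, vecPoly_apply, mul_sum, map_sum]
  refine sum_congr rfl fun b _ => ?_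
  rw [mul_smul_comm, map_smul]

theorem blockRow_mulVec [CharZero 𝕜] (q r ν k : ℕ) (z : 𝕜) (x : Fin ν × Fin r → 𝕜) (a : Fin q) :
    (blockRow q r ν k z).mulVec x a =
      (hasseDeriv k (leibnizSum ν (polySeq ν r x) a)).eval z := by
  rw [leibnizSum_polySeq, map_sum, eval_finsetSum]
  refine sum_congr rfl fun c _ => ?_
  rw [map_smul, eval_smul, smul_eq_mul, mul_comm, ← inv_factorial_mul_matDeriv_M]
  rfl

theorem calN_mulVec (q r μ ν : ℕ) (z : 𝕜) (x : Fin ν × Fin r → 𝕜) (a : Fin μ × Fin q) :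
    (calN q r μ ν z).mulVec x a = (blockRow q r ν a.1 z).mulVec x a.2 := rfl

/-- The entry `t^a t^b` of `M` and the scaling by `i! j!` are symmetric, so left multiplication
obeys the same formula with `(μ, q)` and `(ν, r)` exchanged. -/
theorem vecMul_calN [CharZero 𝕜] (q r μ ν : ℕ) (z : 𝕜) (y : Fin μ × Fin q → 𝕜)
    (c : Fin ν × Fin r) :
    Matrix.vecMul y (calN q r μ ν z) c =
      (hasseDeriv (c.1 : ℕ) (leibnizSum μ (polySeq μ q y) c.2)).eval z := by
  rw [leibnizSum_polySeq, map_sum, eval_finsetSum]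
  refine sum_congr rfl fun a _ => ?_
  rw [map_smul, eval_smul, smul_eq_mul, mul_comm (X ^ _), ← inv_factorial_mul_matDeriv_M,
    mul_comm (((c.1 : ℕ) ! : 𝕜)), add_comm (c.1 : ℕ)]
  rfl

/-- For `μ ≤ r` and `q ≤ ν` the rows of `𝒩(z)` are linearly independent. -/
theorem linearIndependent_row_calN [CharZero 𝕜] {q r μ ν : ℕ} (hμ : μ ≤ r) (hν : q ≤ ν) (z : 𝕜) :
    LinearIndependent 𝕜 (calN q r μ ν z).row := by
  rw [← Matrix.vecMul_injective_iff, ← Matrix.coe_vecMulLinear, injective_iff_map_eq_zero]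
  intro y hy
  refine eq_zero_of_polySeq (eq_zero_of_leibnizSum (z := z) (d := q) (r := r)
    (polySeq_eq_zero μ q y) (degree_polySeq_lt μ q y) hμ fun b hb => ?_)
  refine dvd_of_eval_hasseDeriv_eq_zero fun k hk => ?_
  -- Vanishing to order `q` needs only the block columns `k < q`, available since `q ≤ ν`.
  have := vecMul_calN q r μ ν z y (⟨k, by omega⟩, ⟨b, hb⟩)
  rw [← this]
  exact congrFun hy _

theorem le_rank_calN [CharZero 𝕜] {q r μ ν : ℕ} (hν : q ≤ ν) (z : 𝕜) :
    q * min μ r ≤ (calN q r μ ν z).rank := by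
  have h : (calN q r (min μ r) ν z) = (calN q r μ ν z).submatrix
      (Prod.map (Fin.castLE (min_le_left μ r)) id) id := rfl
  have h1 := (linearIndependent_row_calN (min_le_right μ r) hν z).rank_matrix
  rw [Fintype.card_prod, Fintype.card_fin, Fintype.card_fin, mul_comm] at h1
  rw [← h1, h]
  exact Matrix.rank_submatrix_le _ _ _

/-! ### The action of `K̄_j(z)` on polynomials -/

/-- The polynomials in the first `q` blocks of a vector. -/
def topPoly {q r ν j : ℕ} (v : BIdx q r ν j → 𝕜) : ℕ → 𝕜[X] :=
  polySeq q (r - j) (fun c => v (Sum.inl c))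

/-- The polynomials in the last `ν - q` blocks of a vector. -/
def botPoly {q r ν j : ℕ} (v : BIdx q r ν j → 𝕜) : ℕ → 𝕜[X] :=
  polySeq (ν - q) r (fun c => v (Sum.inr c))

theorem eq_zero_of_topPoly_botPoly {q r ν j : ℕ} {v : BIdx q r ν j → 𝕜}
    (ht : ∀ k, topPoly v k = 0) (hb : ∀ k, botPoly v k = 0) : v = 0 := by
  have h1 := eq_zero_of_polySeq ht
  have h2 := eq_zero_of_polySeq hb
  ext (c | c)
  · exact congrFun h1 c
  · exact congrFun h2 c

theorem polySeq_add (n r : ℕ) (x y : Fin n × Fin r → 𝕜) (k : ℕ) :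
    polySeq n r (x + y) k = polySeq n r x k + polySeq n r y k := by
  unfold polySeq
  split_ifs
  · rw [← map_add]
    rfl
  · rw [add_zero]

theorem polySeq_neg (n r : ℕ) (x : Fin n × Fin r → 𝕜) (k : ℕ) :
    polySeq n r (-x) k = - polySeq n r x k := by
  unfold polySeq
  split_ifs
  · rw [← map_neg]
    rfl
  · rw [neg_zero]

theorem polySeq_kronecker_mulVec {m n r s : ℕ} (A : Matrix (Fin m) (Fin n) 𝕜)
    (B : Matrix (Fin r) (Fin s) 𝕜) (T : 𝕜[X] →ₗ[𝕜] 𝕜[X])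
    (hB : ∀ v, vecPoly r (B.mulVec v) = T (vecPoly s v)) (x : Fin n × Fin s → 𝕜) (k : Fin m) :
    polySeq m r ((A ⊗ₖ B).mulVec x) k = ∑ l, A k l • T (polySeq n s x l) := by
  have h : (fun b => (A ⊗ₖ B).mulVec x (k, b)) =
      ∑ l, A k l • B.mulVec (fun b => x (l, b)) := by
    ext b
    simp only [Matrix.mulVec, dotProduct, Fintype.sum_prod_type, Finset.sum_apply, Pi.smul_apply,
      smul_eq_mul, Matrix.kroneckerMap_apply, mul_sum, mul_assoc]
  rw [polySeq_fin, h, map_sum]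
  refine sum_congr rfl fun l _ => ?_
  rw [map_smul, hB, polySeq_fin]

theorem sum_shift_smul {n : ℕ} (k : Fin n) (x : ℕ → 𝕜[X]) (hx : x n = 0) :
    ∑ l : Fin n, shift 𝕜 n k l • x l = x (k + 1) := by
  simp only [shift, Matrix.of_apply, ite_smul, one_smul, zero_smul]
  by_cases h : (k : ℕ) + 1 < n
  · rw [sum_eq_single_of_mem ⟨(k : ℕ) + 1, h⟩ (mem_univ _)]
    · simp
    · intro b _ hb
      refine if_neg fun h' => hb ?_
      exact Fin.ext h'.symm
  · have hk := k.2
    rw [show (k : ℕ) + 1 = n by omega, hx]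
    refine sum_eq_zero fun b _ => if_neg ?_
    have := b.2
    omega

theorem sum_corner_smul {m n : ℕ} (k : Fin m) (x : ℕ → 𝕜[X]) (hx : ∀ k, n ≤ k → x k = 0) :
    ∑ l : Fin n, corner 𝕜 m n k l • x l = if (k : ℕ) + 1 = m then x 0 else 0 := by
  simp only [corner, Matrix.of_apply, ite_smul, one_smul, zero_smul]
  by_cases h : (k : ℕ) + 1 = m
  · simp only [h, true_and, if_true]
    by_cases hn : 0 < n
    · rw [sum_eq_single_of_mem ⟨0, hn⟩ (mem_univ _)]
      · simp
      · intro b _ hb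
        refine if_neg fun h' => hb ?_
        exact Fin.ext h'
    · rw [hx 0 (by omega)]
      refine sum_eq_zero fun b _ => ?_
      have := b.2
      omega
  · simp [h]

theorem sum_one_smul {n : ℕ} (k : Fin n) (x : ℕ → 𝕜[X]) :
    ∑ l : Fin n, (1 : Matrix (Fin n) (Fin n) 𝕜) k l • x l = x k := by
  rw [sum_eq_single_of_mem k (mem_univ _)]
  · simp
  · intro b _ hb
    rw [Matrix.one_apply_ne' hb, zero_smul]

/-- The image of a vector under a matrix has the polynomial predicted by the images of the
standard basis vectors. -/
theorem vecPoly_mulVec {r s : ℕ} (B : Matrix (Fin r) (Fin s) 𝕜) (T : 𝕜[X] →ₗ[𝕜] 𝕜[X])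
    (h : ∀ b : Fin s, ∀ a, (T (X ^ (b : ℕ))).coeff a = if h : a < r then B ⟨a, h⟩ b else 0)
    (v : Fin s → 𝕜) : vecPoly r (B.mulVec v) = T (vecPoly s v) := by
  ext a
  rw [vecPoly_apply s, map_sum, finsetSum_coeff, coeff_vecPoly]
  simp only [map_smul, coeff_smul, h]
  split_ifs
  · simp [Matrix.mulVec, dotProduct, mul_comm]
  · simp

theorem vecPoly_F_mulVec (r j : ℕ) (z : 𝕜) (v : Fin (r - (j + 1)) → 𝕜) :
    vecPoly (r - j) ((F r j z).mulVec v) = LinearMap.mulLeft 𝕜 (X - C z) (vecPoly _ v) := by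
  refine vecPoly_mulVec _ _ (fun b a => ?_) v
  have hb := b.2
  rw [LinearMap.mulLeft_apply, sub_mul, coeff_sub, coeff_C_mul, ← pow_succ', coeff_X_pow,
    coeff_X_pow]
  simp only [F, Matrix.of_apply]
  split_ifs <;> first | omega | simp

theorem vecPoly_matDeriv_F_mulVec (r j : ℕ) (z : 𝕜) (v : Fin (r - (j + 1)) → 𝕜) :
    vecPoly (r - j) ((matDeriv 1 (F r j) z).mulVec v) =
      (-LinearMap.id : 𝕜[X] →ₗ[𝕜] 𝕜[X]) (vecPoly _ v) := by
  refine vecPoly_mulVec _ _ (fun b a => ?_) v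
  have hb := b.2
  rw [LinearMap.neg_apply, LinearMap.id_apply, coeff_neg, coeff_X_pow]
  simp only [matDeriv, F, Matrix.of_apply, iteratedDeriv_one]
  by_cases hab : a = b
  · have hs : HasDerivAt (fun x : 𝕜 => -x) (-1) z := (hasDerivAt_id z).neg
    rw [if_pos hab, dif_pos (by omega)]
    simp only [hab, if_true]
    exact hs.deriv.symm
  · simp only [hab, if_false]
    simp

theorem vecPoly_G_mulVec (r : ℕ) (z : 𝕜) (v : Fin r → 𝕜) :
    vecPoly r ((G r z).mulVec v) = divDiff z (vecPoly _ v) := by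
  refine vecPoly_mulVec _ _ (fun b a => ?_) v
  have hb := b.2
  have := coeff_divDiff_iterate_X_pow z 0 b a
  rw [zero_add, pow_one] at this
  rw [this]
  simp only [G, Matrix.of_apply]
  split_ifs <;> first | omega | simp

theorem vecPoly_Gtop_mulVec [CharZero 𝕜] (r j : ℕ) (z : 𝕜) (v : Fin r → 𝕜) :
    vecPoly (r - j) (((j ! : 𝕜)⁻¹ • matDeriv j (Gtop r j) z).mulVec v) =
      (divDiff z ^ (j + 1)) (vecPoly _ v) := by
  refine vecPoly_mulVec _ _ (fun b a => ?_) v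
  have hb := b.2
  rw [coeff_divDiff_iterate_X_pow]
  by_cases hab : a < b
  · rw [if_pos hab]
    by_cases haj : a < r - j
    · have hj : (j ! : 𝕜) ≠ 0 := Nat.cast_ne_zero.2 j.factorial_ne_zero
      rw [dif_pos haj]
      simp only [matDeriv, Gtop, G, Matrix.of_apply, Matrix.smul_apply, Matrix.submatrix_apply,
        id_eq, Fin.val_castLE, hab, if_true]
      rw [iteratedDeriv_pow, Nat.descFactorial_eq_factorial_mul_choose, smul_eq_mul]
      push_cast
      field_simp
    -- Keeping only `r - j` rows loses nothing: in the omitted rows `b - a - 1 < j`, so the binomial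
    -- vanishes.
    · rw [dif_neg haj, Nat.choose_eq_zero_of_lt (by omega), Nat.cast_zero, zero_mul]
  · rw [if_neg hab]
    simp only [matDeriv, Gtop, G, Matrix.of_apply, Matrix.smul_apply, Matrix.submatrix_apply,
      id_eq, Fin.val_castLE, hab, if_false]
    simp

theorem topPoly_Kbar_mulVec [CharZero 𝕜] (q r ν j : ℕ) (z : 𝕜) (v : BIdx q r ν (j + 1) → 𝕜)
    (k : ℕ) (hk : k < q) :
    topPoly ((Kbar q r ν j z).mulVec v) k = (X - C z) * topPoly v k - topPoly v (k + 1)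
      - if k + 1 = q then (divDiff z ^ (j + 1)) (botPoly v 0) else 0 := by
  have h : (fun c => (Kbar q r ν j z).mulVec v (Sum.inl c)) =
      ((1 : Matrix (Fin q) (Fin q) 𝕜) ⊗ₖ F r j z).mulVec (fun c => v (Sum.inl c)) +
      (shift 𝕜 q ⊗ₖ matDeriv 1 (F r j) z).mulVec (fun c => v (Sum.inl c)) +
      -(corner 𝕜 q (ν - q) ⊗ₖ ((j ! : 𝕜)⁻¹ • matDeriv j (Gtop r j) z)).mulVec
        (fun c => v (Sum.inr c)) := by
    rw [← Matrix.add_mulVec, ← Matrix.neg_mulVec]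
    ext c
    rw [Kbar, Matrix.fromBlocks_mulVec]
    rfl
  have h1 := polySeq_kronecker_mulVec 1 (F r j z) _ (vecPoly_F_mulVec r j z)
    (fun c => v (Sum.inl c)) ⟨k, hk⟩
  have h2 := polySeq_kronecker_mulVec (shift 𝕜 q) (matDeriv 1 (F r j) z) _
    (vecPoly_matDeriv_F_mulVec r j z) (fun c => v (Sum.inl c)) ⟨k, hk⟩
  have h3 := polySeq_kronecker_mulVec (corner 𝕜 q (ν - q)) _ _
    (vecPoly_Gtop_mulVec r j z) (fun c => v (Sum.inr c)) ⟨k, hk⟩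
  rw [sum_one_smul ⟨k, hk⟩ (fun l => LinearMap.mulLeft 𝕜 (X - C z) (polySeq _ _ _ l))] at h1
  rw [sum_shift_smul ⟨k, hk⟩ (fun l => (-LinearMap.id : 𝕜[X] →ₗ[𝕜] 𝕜[X]) (polySeq _ _ _ l))
    (by rw [polySeq_eq_zero _ _ _ _ le_rfl, map_zero])] at h2
  rw [sum_corner_smul ⟨k, hk⟩ (fun l => (divDiff z ^ (j + 1)) (polySeq _ _ _ l))
    (fun l hl => by rw [polySeq_eq_zero _ _ _ _ hl, map_zero])] at h3
  simp only at h1 h2 h3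
  rw [topPoly, h, polySeq_add, polySeq_add, polySeq_neg, h1, h2, h3]
  simp only [topPoly, botPoly, LinearMap.mulLeft_apply, LinearMap.neg_apply, LinearMap.id_apply]
  ring

theorem botPoly_Kbar_mulVec (q r ν j : ℕ) (z : 𝕜) (v : BIdx q r ν (j + 1) → 𝕜) (k : ℕ) :
    botPoly ((Kbar q r ν j z).mulVec v) k = botPoly v k - divDiff z (botPoly v (k + 1)) := by
  by_cases hk : k < ν - q
  · have h : (fun c => (Kbar q r ν j z).mulVec v (Sum.inr c)) =
        (fun c => v (Sum.inr c)) + -(shift 𝕜 (ν - q) ⊗ₖ G r z).mulVec (fun c => v (Sum.inr c)) := by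
      rw [← sub_eq_add_neg]
      conv_rhs => lhs; rw [← Matrix.one_mulVec (fun c => v (Sum.inr c))]
      rw [← Matrix.sub_mulVec, ← Matrix.one_kronecker_one]
      ext c
      rw [Kbar, Matrix.fromBlocks_mulVec]
      simp only [Matrix.zero_mulVec, zero_add, Sum.elim_inr]
      rfl
    have h2 := polySeq_kronecker_mulVec (shift 𝕜 (ν - q)) (G r z) _
      (vecPoly_G_mulVec r z) (fun c => v (Sum.inr c)) ⟨k, hk⟩
    rw [sum_shift_smul ⟨k, hk⟩ (fun l => divDiff z (polySeq _ _ _ l))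
      (by rw [polySeq_eq_zero _ _ _ _ le_rfl, map_zero])] at h2
    simp only at h2
    rw [botPoly, h, polySeq_add, polySeq_neg, h2, botPoly, sub_eq_add_neg]
  · simp only [botPoly]
    rw [polySeq_eq_zero _ _ _ _ (by omega), polySeq_eq_zero _ _ _ _ (by omega),
      polySeq_eq_zero _ _ _ _ (by omega), map_zero, sub_zero]

/-! ### Injectivity of `K̄_j(z)` -/

theorem eq_zero_of_recursion {n : ℕ} {x : ℕ → 𝕜[X]} (hx : ∀ k, n ≤ k → x k = 0)
    (h : ∀ k < n, x (k + 1) = 0 → x k = 0) (k : ℕ) : x k = 0 := by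
  rcases le_total n k with hk | hk
  · exact hx k hk
  · induction hk using Nat.decreasingInduction with
    | self => exact hx n le_rfl
    | of_succ k hk ih => exact h k hk ih

/-- `K̄_j(z)` has full column rank. -/
theorem Kbar_mulVec_injective [CharZero 𝕜] (q r ν j : ℕ) (z : 𝕜) :
    Function.Injective (Kbar q r ν j z).mulVec := by
  rw [← Matrix.coe_mulVecLin, injective_iff_map_eq_zero]
  intro v hv
  rw [Matrix.mulVecLin_apply] at hv
  have ht0 : ∀ k, topPoly ((Kbar q r ν j z).mulVec v) k = 0 := fun k => by
    rw [hv]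
    simp only [topPoly, polySeq]
    split_ifs
    · exact map_zero (vecPoly _)
    · rfl
  have hb0 : ∀ k, botPoly ((Kbar q r ν j z).mulVec v) k = 0 := fun k => by
    rw [hv]
    simp only [botPoly, polySeq]
    split_ifs
    · exact map_zero (vecPoly _)
    · rfl
  have hb : ∀ k, botPoly v k = 0 := by
    refine eq_zero_of_recursion (n := ν - q) (polySeq_eq_zero _ _ _) fun k _ hk => ?_
    have := hb0 k
    rwa [botPoly_Kbar_mulVec, hk, map_zero, sub_zero] at this
  refine eq_zero_of_topPoly_botPoly ?_ hb
  refine eq_zero_of_recursion (n := q) (polySeq_eq_zero _ _ _) fun k hkq hk => ?_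
  have := ht0 k
  rw [topPoly_Kbar_mulVec _ _ _ _ _ _ _ hkq, hk, hb, map_zero, ite_self, sub_zero, sub_zero] at this
  exact (mul_eq_zero.1 this).resolve_left (X_sub_C_ne_zero z)

/-! ### Annihilation by the products of the `K̄_j(z)` -/

/-- The sequence of `ν` polynomials of a vector, the last `ν - q` of which are replaced by their
`j`-th divided differences. -/
def fullPoly {q r ν j : ℕ} (z : 𝕜) (v : BIdx q r ν j → 𝕜) (k : ℕ) : 𝕜[X] :=
  if k < q then topPoly v k else (divDiff z ^ j) (botPoly v (k - q))

theorem fullPoly_eq_zero {q r ν j : ℕ} (z : 𝕜) (v : BIdx q r ν j → 𝕜) (k : ℕ) (hν : q ≤ ν)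
    (h : ν ≤ k) : fullPoly z v k = 0 := by
  rw [fullPoly, if_neg (by omega), botPoly, polySeq_eq_zero _ _ _ _ (by omega), map_zero]

/-- Multiplying a `(j+1)`-st divided difference by `t - z` returns the `j`-th one minus its value at
`z`. This makes the lower blocks obey the recursion of the upper ones up to a constant; the corner
block joins the two at `k = q - 1`. -/
theorem fullPoly_Kbar_mulVec [CharZero 𝕜] (q r ν j : ℕ) (z : 𝕜) (v : BIdx q r ν (j + 1) → 𝕜)
    (k : ℕ) :
    fullPoly z ((Kbar q r ν j z).mulVec v) k =
      (X - C z) * fullPoly z v k - fullPoly z v (k + 1) +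
        C (if k < q then 0 else ((divDiff z ^ j) (botPoly v (k - q))).eval z) := by
  unfold fullPoly
  by_cases hk : k < q
  · rw [if_pos hk, if_pos hk, if_pos hk, topPoly_Kbar_mulVec _ _ _ _ _ _ _ hk, C_0, add_zero]
    by_cases hk1 : k + 1 = q
    · rw [if_pos hk1, if_neg (by omega), show k + 1 - q = 0 by omega, topPoly,
        polySeq_eq_zero _ _ _ (k + 1) (by omega), sub_zero]
    · rw [if_neg hk1, if_pos (by omega), sub_zero]
  · rw [if_neg hk, if_neg hk, if_neg hk, if_neg (by omega), botPoly_Kbar_mulVec, map_sub,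
      pow_succ' (divDiff z) j, Module.End.mul_apply, X_sub_C_mul_divDiff, ← pow_succ', pow_succ,
      Module.End.mul_apply, show k + 1 - q = k - q + 1 by omega]
    ring

theorem X_sub_C_pow_mul_expShift [CharZero 𝕜] (q r ν i : ℕ) (hν : q < ν) (z : 𝕜)
    (v : BIdx q r ν (i + 1) → 𝕜) (k : ℕ) (hk : k < q) :
    (X - C z) ^ (i + 1) * expShift ν (fullPoly z v) k =
      expShift ν (fullPoly z ((KbarProd q r ν i z).mulVec v)) k := by
  have step : ∀ (j : ℕ) (w : BIdx q r ν (j + 1) → 𝕜),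
      expShift ν (fullPoly z ((Kbar q r ν j z).mulVec w)) k =
        (X - C z) * expShift ν (fullPoly z w) k := fun j w => by
    rw [expShift_X_sub_C_mul_sub ν z _ _ _ (fun k => fullPoly_eq_zero z w k hν.le)
      (fullPoly_Kbar_mulVec q r ν j z w) k (by omega), if_pos hk, C_0, add_zero]
  induction i with
  | zero =>
    refine .trans ?_ (step 0 v).symm
    rw [pow_one]
  | succ i ih =>
    rw [KbarProd, ← Matrix.mulVec_mulVec, ← ih, step]
    ring

theorem calKbar_mulVec (q r ν i : ℕ) (z : 𝕜) (v : BIdx q r ν (i + 1) → 𝕜) :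
    (calKbar q r ν i z).mulVec v = (KbarProd q r ν i z).mulVec v ∘ splitIdx q r ν := rfl

theorem polySeq_comp_splitIdx (q r ν : ℕ) (hν : q ≤ ν) (z : 𝕜) (w : BIdx q r ν 0 → 𝕜) :
    polySeq ν r (w ∘ splitIdx q r ν) = fullPoly z w := by
  ext1 k
  unfold fullPoly topPoly botPoly polySeq
  by_cases hk : k < q
  · rw [dif_pos (by omega), if_pos hk, dif_pos hk]
    simp only [Function.comp_apply, splitIdx, hk, dif_pos]
    rfl
  · rw [if_neg hk, pow_zero, Module.End.one_apply]
    by_cases hkν : k < ν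
    · rw [dif_pos hkν, dif_pos (by omega)]
      simp only [Function.comp_apply, splitIdx, hk, dif_neg, not_false_eq_true]
    · rw [dif_neg hkν, dif_neg (by omega)]

theorem blockRow_mul_calKbar [CharZero 𝕜] {q r ν : ℕ} (hν : q < ν) (z : 𝕜) {i k : ℕ} (hk : k ≤ i) :
    blockRow q r ν k z * calKbar q r ν i z = 0 := by
  refine Matrix.ext_of_mulVec_single fun c => ?_
  rw [← Matrix.mulVec_mulVec, Matrix.zero_mulVec]
  generalize (Pi.single c 1 : BIdx q r ν (i + 1) → 𝕜) = v
  ext a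
  rw [blockRow_mulVec, calKbar_mulVec, polySeq_comp_splitIdx q r ν hν.le z]
  refine eval_hasseDeriv_eq_zero_of_dvd (m := i + 1)
    (dvd_leibnizSum (fun k => fullPoly_eq_zero z _ k hν.le) fun l hl => ?_) (by omega)
  rw [← X_sub_C_pow_mul_expShift q r ν i hν z v l (hl.trans_lt a.2)]
  exact dvd_mul_right _ _

/-! ### Ranks and dimension count -/

theorem splitIdx_surjective {q r ν : ℕ} (hν : q ≤ ν) : Function.Surjective (splitIdx q r ν) := by
  rintro (⟨k, b⟩ | ⟨k, b⟩)
  · exact ⟨(⟨k, by omega⟩, b), by simp [splitIdx]⟩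
  · exact ⟨(⟨k + q, by omega⟩, b), by simp [splitIdx]⟩

theorem KbarProd_mulVec_injective [CharZero 𝕜] (q r ν i : ℕ) (z : 𝕜) :
    Function.Injective (KbarProd q r ν i z).mulVec := by
  induction i with
  | zero => exact Kbar_mulVec_injective q r ν 0 z
  | succ i ih =>
    intro v w h
    simp only [KbarProd, ← Matrix.mulVec_mulVec] at h
    exact Kbar_mulVec_injective q r ν (i + 1) z (ih h)

theorem calKbar_mulVec_injective [CharZero 𝕜] {q ν : ℕ} (hν : q ≤ ν) (r i : ℕ) (z : 𝕜) :
    Function.Injective (calKbar q r ν i z).mulVec := fun _ _ h =>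
  KbarProd_mulVec_injective q r ν i z ((splitIdx_surjective hν).injective_comp_right h)

theorem rank_calKbar [CharZero 𝕜] {q ν : ℕ} (hν : q ≤ ν) (r i : ℕ) (z : 𝕜) :
    (calKbar q r ν i z).rank = Fintype.card (BIdx q r ν (i + 1)) := by
  rw [Matrix.rank, LinearMap.finrank_range_of_inj (calKbar_mulVec_injective hν r i z),
    Module.finrank_pi]

theorem card_BIdx_add (q r ν μ : ℕ) (hν : q ≤ ν) :
    Fintype.card (BIdx q r ν μ) + q * min μ r = ν * r := by
  obtain ⟨d, rfl⟩ := Nat.exists_eq_add_of_le hν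
  have h : r - μ + min μ r = r := by omega
  simp only [Fintype.card_sum, Fintype.card_prod, Fintype.card_fin, Nat.add_sub_cancel_left]
  nth_rewrite 4 [← h]
  nth_rewrite 2 [← h]
  ring

theorem range_calKbar_le_ker_calN [CharZero 𝕜] {q r μ ν : ℕ} (hν : q < ν) (z : 𝕜) :
    LinearMap.range (calKbar q r ν (μ - 1) z).mulVecLin ≤
      LinearMap.ker (calN q r μ ν z).mulVecLin := by
  rintro _ ⟨v, rfl⟩
  rw [LinearMap.mem_ker, Matrix.mulVecLin_apply, Matrix.mulVecLin_apply]
  ext a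
  have ha := a.1.2
  rw [calN_mulVec, Matrix.mulVec_mulVec, blockRow_mul_calKbar hν z (by omega), Matrix.zero_mulVec]
  rfl

end BlockHankel

end

theorem mainTheorem4 {𝕜 : Type*} [RCLike 𝕜] (q r μ ν : ℕ) (hq : 0 < q) (hr : 0 < r)
    (hμ : 0 < μ) (hν₁ : q + 1 ≤ ν) (hν₂ : ν < q + r) (z : 𝕜) :
    (∀ i k : ℕ, k ≤ i →
      BlockHankel.blockRow q r ν k z * BlockHankel.calKbar q r ν i z = 0) ∧
    (μ ≤ r - 1 →
      Fintype.card (BlockHankel.BIdx q r ν (μ - 1 + 1)) = ν * r - q * μ ∧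
      (BlockHankel.calKbar q r ν (μ - 1) z).rank = ν * r - q * μ) ∧
    (r ≤ μ →
      Fintype.card (BlockHankel.BIdx q r ν (μ - 1 + 1)) = (ν - q) * r ∧
      (BlockHankel.calKbar q r ν (μ - 1) z).rank = (ν - q) * r) ∧
    LinearIndependent 𝕜 (BlockHankel.calKbar q r ν (μ - 1) z).col ∧
    Submodule.span 𝕜 (Set.range (BlockHankel.calKbar q r ν (μ - 1) z).col) =
      LinearMap.ker (BlockHankel.calN q r μ ν z).mulVecLin ∧
    Module.finrank 𝕜 (LinearMap.ker (BlockHankel.calN q r μ ν z).mulVecLin) =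
      ν * r - q * min μ r ∧
    (BlockHankel.calN q r μ ν z).rank = q * min μ r ∧
    q * min μ r < ν * r ∧
    ¬ LinearIndependent 𝕜 (BlockHankel.calN q r μ ν z).col := by
  have hν : q < ν := hν₁
  have hcard := BlockHankel.card_BIdx_add q r ν (μ - 1 + 1) hν.le
  have hK := BlockHankel.rank_calKbar hν.le r (μ - 1) z
  have hle := BlockHankel.range_calKbar_le_ker_calN (r := r) (μ := μ) hν z
  have hN := BlockHankel.le_rank_calN (r := r) (μ := μ) hν.le z
  have hrn := LinearMap.finrank_range_add_finrank_ker (BlockHankel.calN q r μ ν z).mulVecLin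
  have hKN := Submodule.finrank_mono hle
  have hlt : q * min μ r < ν * r :=
    (Nat.mul_le_mul_left q (min_le_right μ r)).trans_lt (Nat.mul_lt_mul_of_pos_right hν hr)
  rw [Module.finrank_pi, Fintype.card_prod, Fintype.card_fin, Fintype.card_fin] at hrn
  change _ = _ at hK
  have e : μ - 1 + 1 = μ := by omega
  rw [← Matrix.rank] at hrn hKN
  have hcard' : Fintype.card (BlockHankel.BIdx q r ν (μ - 1 + 1)) + q * min μ r = ν * r := by
    rw [← hcard, e]
  -- The range of `𝒦̄^{μ-1}(z)` lies in the kernel and has dimension `ν r - q min(μ, r)`, so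
  -- rank-nullity bounds the rank above; `hN` bounds it below.
  have hrank : (BlockHankel.calN q r μ ν z).rank = q * min μ r := by omega
  refine ⟨fun i k hk => BlockHankel.blockRow_mul_calKbar hν z hk, fun h => ?_, fun h => ?_,
    Matrix.mulVec_injective_iff.1 (BlockHankel.calKbar_mulVec_injective hν.le r _ z), ?_,
    by omega, hrank, hlt, fun h => ?_⟩
  · rw [min_eq_left (by omega)] at hcard'
    omega
  · rw [min_eq_right h] at hcard'
    rw [hK, Nat.sub_mul]
    omega
  · rw [← Matrix.range_mulVecLin]
    -- The inclusion is an equality because the exact rank of `𝒩(z)` forces equal dimensions.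
    refine Submodule.eq_of_le_of_finrank_eq hle ?_
    rw [← Matrix.rank]
    omega
  · have h1 := LinearIndependent.rank_matrix (M := (BlockHankel.calN q r μ ν z).transpose) h
    rw [Matrix.rank_transpose, Fintype.card_prod, Fintype.card_fin, Fintype.card_fin] at h1
    omega
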